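/- Let $\Gamma$ be a (compact) tropical curve given by a finite connected weighted graph $G$ (loops and multiple edges allowed) with a nonempty vertex set, oriented edges $e$ from $e^-$ to $e^+$ and edge lengths $\ell(e)>0$: $\Gamma$ is obtained by gluing the segments $[0,\ell(e)]$ at the vertices according to $G$, and carries the path metric. The segments of $\Gamma$ are the images of the intervals $[0,\ell(e)]$. Let $\Omega(\Gamma)$ be the real vector space of harmonic $1$-forms $\omega=\sum_e\omega_e\,de$, i.e. $\sum_{e^+=x}\omega_e=\sum_{e^-=x}\omega_e$ for every vertex $x$. The integral of $\omega$ over a $1$-chain $\alpha=\sum_e\alpha(e)\,e$ is $\int_\alpha\omega=\sum_e\alpha(e)\,\omega_e\,\ell(e)$, and likewise for every subdivision of $G$, where $\omega$ keeps the coefficient $\omega_e$ on every part of $e$. Integral cycles act on $\Omega(\Gamma)$ by integration, which embeds $H_1(\Gamma,\mathbb Z)$ in $\Omega(\Gamma)^*$; put $J(\Gamma)=\Omega(\Gamma)^*/H_1(\Gamma,\mathbb Z)$. For $p\in\Gamma$ the Abel–Jacobi map $\Phi_p:\Gamma\to J(\Gamma)$ sends $q$ to the class of the functional $\omega\mapsto\int_P\omega$,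 where $P$ is any path from $p$ to $q$ in a subdivision of $G$ having $p$ and $q$ as vertices. Let $\Omega_{\mathbb Z}(\Gamma)\subset\Omega(\Gamma)$ be the group of harmonic forms with all $\omega_e\in\mathbb Z$ and let $\Omega_{\mathbb Z}(\Gamma)^*=\{\varphi\in\Omega(\Gamma)^*:\varphi(\Omega_{\mathbb Z}(\Gamma))\subset\mathbb Z\}$. An element $\lambda$ of this lattice is primitive if it is not of the form $n\lambda'$ with $\lambda'$ in the lattice and $n>1$ an integer. The tropical length of $v=t\lambda$, with $t\in\mathbb R$ and $\lambda$ primitive, is $\|v\|_{\mathbb Z}=|t|$. The tropical length of a path in $J(\Gamma)$ that has a continuous lift to $\Omega(\Gamma)^*$ consisting of finitely many straight pieces, each in the direction of a real multiple of an element of $\Omega_{\mathbb Z}(\Gamma)^*$, is the sum of the tropical lengths of the displacement vectors of these pieces. We say that $\Phi_p$ is a tropical isometry along a segment $e$ if, with respect to the unit-speed parametrization $[0,\ell(e)]\to\Gamma$ of $e$: (a) the differential of $\Phi_p$, computed on a continuous lift to $\Omega(\Gamma)^*$, carries unit tangent vectors of $e$ (one-sided ones at its ends) to vectors of tropical length $1$;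 (b) locally on $e$, the image of the part of $e$ between two points has a tropical length, equal to the distance of the two points in $\Gamma$; and (c) the image of every part $[s,t]\subset[0,\ell(e)]$ of $e$, in particular of $e$ itself, has a tropical length, equal to $t-s$. **Theorem.** For every tropical curve $\Gamma$ and every point $p\in\Gamma$, the Abel–Jacobi map $\Phi_p:\Gamma\to J(\Gamma)$ is a tropical isometry along every segment $e$ of $\Gamma$ that it does not collapse to a single point. In particular, if $\Gamma$ is $2$-edge-connected (that is, $G$ is connected and remains connected after the deletion of any one edge), then $\Phi_p$ is a tropical isometry along every segment of $\Gamma$. -/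

import Mathlib

/-- An oriented multigraph, possibly with loops and multiple edges. -/
structure Multigraph (V E : Type*) where
  tail : E → V
  head : E → V

namespace Multigraph

/-- A path: a finite sequence of vertices and edges, every edge being traversed from its tail to
its head (`forward`) or from its head to its tail (`backward`). -/
inductive EdgePath {V E : Type*} (G : Multigraph V E) : V → V → Type _
  | nil (x : V) : EdgePath G x x
  | forward {x y z : V} (e : E) (hx : G.tail e = x) (hy : G.head e = y)
      (P : EdgePath G y z) : EdgePath G x z
  | backward {x y z : V} (e : E) (hx : G.head e = x) (hy : G.tail e = y)
      (P : EdgePath G y z) : EdgePath G x z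

namespace EdgePath

open Classical in
/-- The integral `1`-chain `α_P` of a path `P`: its coefficient at `e` is the number of times `P`
traverses `e` forwards minus the number of times `P` traverses `e` backwards. -/
noncomputable def chain {V E : Type*} {G : Multigraph V E} : {x y : V} → EdgePath G x y → E → ℤ
  | _, _, nil _ => 0
  | _, _, forward e _ _ P => Pi.single e 1 + chain P
  | _, _, backward e _ _ P => - Pi.single e 1 + chain P

/-- The sum of the weights `ℓ` of the edges of a path, with multiplicity. -/
def weight {V E : Type*} {G : Multigraph V E} (ℓ : E → ℝ) : {x y : V} → EdgePath G x y → ℝ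
  | _, _, nil _ => 0
  | _, _, forward e _ _ P => ℓ e + weight ℓ P
  | _, _, backward e _ _ P => ℓ e + weight ℓ P

theorem nonempty_trans {V E : Type*} {G : Multigraph V E} {x y z : V} (P : EdgePath G x y)
    (hQ : Nonempty (EdgePath G y z)) : Nonempty (EdgePath G x z) := by
  induction P with
  | nil => exact hQ
  | forward e hx hy P ih => exact ⟨forward e hx hy (ih hQ).some⟩
  | backward e hx hy P ih => exact ⟨backward e hx hy (ih hQ).some⟩

theorem nonempty_symm {V E : Type*} {G : Multigraph V E} {x y : V} (P : EdgePath G x y) :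
    Nonempty (EdgePath G y x) := by
  induction P with
  | nil => exact ⟨nil _⟩
  | forward e hx hy P ih => exact nonempty_trans ih.some ⟨backward e hy hx (nil _)⟩
  | backward e hx hy P ih => exact nonempty_trans ih.some ⟨forward e hy hx (nil _)⟩

end EdgePath

/-- Any two vertices are joined by a path. -/
def IsConnected {V E : Type*} (G : Multigraph V E) : Prop :=
  ∀ x y : V, Nonempty (G.EdgePath x y)

/-- The multigraph `G - e`, obtained by deleting the edge `e` and keeping all vertices. -/
def deleteEdge {V E : Type*} (G : Multigraph V E) (e : E) : Multigraph V {e' : E // e' ≠ e} where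
  tail e' := G.tail e'
  head e' := G.head e'

end Multigraph

/-- A weighted graph: a connected oriented multigraph with a nonempty set of vertices and with
positive edge lengths. (If `E` is finite, then so is `V`, by connectedness.) -/
structure WeightedGraph (V E : Type*) extends Multigraph V E where
  nonempty : Nonempty V
  connected : toMultigraph.IsConnected
  length : E → ℝ
  length_pos : ∀ e, 0 < length e

namespace WeightedGraph

/-! ### Chains, harmonic forms, integration -/

/-- The integral `∫_α ω = ∑ α(e) ω_e ℓ(e)` of the `1`-form `ω = ∑ ω_e de` along the real `1`-chain
`α = ∑ α(e) e`; that is, the bilinear pairing with `∫_e de = ℓ(e)` and `∫_{e'} de = 0` for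
`e' ≠ e`. -/
noncomputable def integral {V E : Type*} [Fintype E] (G : WeightedGraph V E)
    (α : E → ℝ) : (E → ℝ) →ₗ[ℝ] ℝ where
  toFun ω := ∑ e, α e * ω e * G.length e
  map_add' ω₁ ω₂ := by
    rw [← Finset.sum_add_distrib]
    exact Finset.sum_congr rfl fun e _ => by simp only [Pi.add_apply]; ring
  map_smul' c ω := by
    simp only [RingHom.id_apply, smul_eq_mul, Finset.mul_sum]
    exact Finset.sum_congr rfl fun e _ => by simp only [Pi.smul_apply, smul_eq_mul]; ring

open Classical in
/-- The space `Ω(G)` of harmonic `1`-forms `∑ ω_e de`. -/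
noncomputable def harmonicForms {V E : Type*} [Fintype E] (G : WeightedGraph V E) :
    Submodule ℝ (E → ℝ) where
  carrier := {ω | ∀ x : V, ∑ e with G.head e = x, ω e = ∑ e with G.tail e = x, ω e}
  zero_mem' x := by simp
  add_mem' {ω₁ ω₂} h₁ h₂ x := by
    simp only [Pi.add_apply, Finset.sum_add_distrib]
    rw [h₁ x, h₂ x]
  smul_mem' c ω h x := by
    simp only [Pi.smul_apply, ← Finset.smul_sum]
    rw [h x]

open Classical in
/-- The group `H₁(G, ℤ)` of integral `1`-cycles. -/
noncomputable def cycles {V E : Type*} [Fintype E] (G : WeightedGraph V E) :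
    AddSubgroup (E → ℤ) where
  carrier := {α | ∀ x : V, ∑ e with G.head e = x, α e - ∑ e with G.tail e = x, α e = 0}
  zero_mem' x := by simp
  add_mem' {α₁ α₂} h₁ h₂ x := by
    have a := h₁ x
    have b := h₂ x
    simp only [Pi.add_apply, Finset.sum_add_distrib]
    omega
  neg_mem' {α} h x := by
    have a := h x
    simp only [Pi.neg_apply, Finset.sum_neg_distrib]
    omega

/-- The dual space `Ω(Γ)^*` of the space of harmonic forms, with its topology as a
finite-dimensional real vector space. -/
abbrev FormsDual {V E : Type*} [Fintype E] (G : WeightedGraph V E) : Type _ :=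
  StrongDual ℝ G.harmonicForms

/-- The functional `∫_α ∈ Ω(G)^*` of an integral `1`-chain `α`, as a homomorphism in `α`. -/
noncomputable def integralFunctional {V E : Type*} [Fintype E] (G : WeightedGraph V E) :
    (E → ℤ) →+ G.FormsDual where
  toFun α := LinearMap.toContinuousLinearMap
    ((G.integral fun e => (α e : ℝ)) ∘ₗ G.harmonicForms.subtype)
  map_zero' := by
    ext ω
    simp [integral]
  map_add' α β := by
    ext ω
    simp only [integral, Pi.add_apply, Int.cast_add, LinearMap.coe_toContinuousLinearMap',
      LinearMap.comp_apply, LinearMap.coe_mk, AddHom.coe_mk, add_apply,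
      ← Finset.sum_add_distrib]
    exact Finset.sum_congr rfl fun e _ => by ring

/-- `H₁(Γ, ℤ)` as a subgroup of `Ω(Γ)^*`, through `α ↦ ∫_α`. -/
noncomputable def periodLattice {V E : Type*} [Fintype E] (G : WeightedGraph V E) :
    AddSubgroup G.FormsDual :=
  G.cycles.map G.integralFunctional

/-- The Jacobian `J(Γ) = Ω(Γ)^* / H₁(Γ, ℤ)`. -/
abbrev Jacobian {V E : Type*} [Fintype E] (G : WeightedGraph V E) : Type _ :=
  G.FormsDual ⧸ G.periodLattice

/-- The tropical structure on the Jacobian: the lattice `Ω_ℤ(Γ)^*` of the functionals on `Ω(Γ)`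
that are integer-valued on all harmonic forms with integer coefficients. -/
def tropicalStructure {V E : Type*} [Fintype E] (G : WeightedGraph V E) :
    AddSubgroup G.FormsDual where
  carrier := {φ | ∀ ω : G.harmonicForms,
    (∀ e, ∃ n : ℤ, (ω : E → ℝ) e = n) → ∃ n : ℤ, φ ω = n}
  zero_mem' ω _ := ⟨0, by simp⟩
  add_mem' {φ ψ} hφ hψ ω hω := by
    obtain ⟨m, hm⟩ := hφ ω hω
    obtain ⟨n, hn⟩ := hψ ω hω
    exact ⟨m + n, by simp [hm, hn]⟩
  neg_mem' {φ} hφ ω hω := by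
    obtain ⟨m, hm⟩ := hφ ω hω
    exact ⟨-m, by simp [hm]⟩

/-! ### The tropical curve and its models -/

/-- The points of the tropical curve `Γ` with model `G`, obtained from `G` by associating with every
edge `e` the segment `[0, ℓ(e)]` and gluing the ends `0` and `ℓ(e)` to the tail and the head of `e`.
Every point is a vertex or an interior point of exactly one segment. -/
inductive Realization {V E : Type*} (G : WeightedGraph V E) : Type _
  | vertex (x : V) : Realization G
  | inner (e : E) (t : ℝ) (h₀ : 0 < t) (h₁ : t < G.length e) : Realization G

open Classical in
/-- The unit-speed parametrization `[0, ℓ(e)] → Γ` of the segment `e`, from tail to head. (Only its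
values on `[0, ℓ(e)]` matter.) -/
noncomputable def onEdge {V E : Type*} (G : WeightedGraph V E) (e : E) (t : ℝ) : G.Realization :=
  if h₀ : 0 < t then
    if h₁ : t < G.length e then .inner e t h₀ h₁ else .vertex (G.head e)
  else .vertex (G.tail e)

/-- The segment `e` of `Γ`, as a set of points. -/
def segment {V E : Type*} (G : WeightedGraph V E) (e : E) : Set G.Realization :=
  G.onEdge e '' Set.Icc 0 (G.length e)

/-- The vertices of the model of `Γ` that refines `G` by turning the points of `S` into vertices. -/
def subdivisionVertices {V E : Type*} (G : WeightedGraph V E) (S : Finset G.Realization) :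
    Set G.Realization :=
  (S : Set G.Realization) ∪ Set.range Realization.vertex

/-- The parameters in `[0, ℓ(e)]` of the points at which the segment `e` is cut. -/
def cuts {V E : Type*} (G : WeightedGraph V E) (S : Finset G.Realization) (e : E) : Set ℝ :=
  {t | t ∈ Set.Icc 0 (G.length e) ∧ G.onEdge e t ∈ G.subdivisionVertices S}

/-- The edges of the model of `Γ` that refines `G` by turning the points of `S` into vertices: the
edge `(e, s, t)` is the part between the successive cuts `s < t` of the segment `e`. -/
def subdivisionEdges {V E : Type*} (G : WeightedGraph V E) (S : Finset G.Realization) :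
    Set (E × ℝ × ℝ) :=
  {c | c.2.1 ∈ G.cuts S c.1 ∧ c.2.2 ∈ G.cuts S c.1 ∧ c.2.1 < c.2.2 ∧
    ∀ u ∈ G.cuts S c.1, ¬ (c.2.1 < u ∧ u < c.2.2)}

theorem onEdge_zero {V E : Type*} (G : WeightedGraph V E) (e : E) :
    G.onEdge e 0 = .vertex (G.tail e) := by
  simp [onEdge]

theorem onEdge_length {V E : Type*} (G : WeightedGraph V E) (e : E) :
    G.onEdge e (G.length e) = .vertex (G.head e) := by
  simp [onEdge, G.length_pos e]

theorem zero_mem_cuts {V E : Type*} (G : WeightedGraph V E) (S : Finset G.Realization) (e : E) :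
    0 ∈ G.cuts S e :=
  ⟨⟨le_rfl, (G.length_pos e).le⟩, Or.inr ⟨_, (G.onEdge_zero e).symm⟩⟩

theorem length_mem_cuts {V E : Type*} (G : WeightedGraph V E) (S : Finset G.Realization) (e : E) :
    G.length e ∈ G.cuts S e :=
  ⟨⟨(G.length_pos e).le, le_rfl⟩, Or.inr ⟨_, (G.onEdge_length e).symm⟩⟩

theorem cuts_finite {V E : Type*} (G : WeightedGraph V E) (S : Finset G.Realization) (e : E) :
    (G.cuts S e).Finite := by
  have hinj : Set.InjOn (G.onEdge e) (G.onEdge e ⁻¹' S ∩ Set.Ioo 0 (G.length e)) := by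
    rintro s ⟨-, hs⟩ t ⟨-, ht⟩ h
    simpa [onEdge, hs.1, hs.2, ht.1, ht.2] using h
  have hfin : (G.onEdge e ⁻¹' S ∩ Set.Ioo 0 (G.length e)).Finite := by
    refine Set.Finite.of_finite_image (S.finite_toSet.subset ?_) hinj
    rintro _ ⟨t, ht, rfl⟩
    exact ht.1
  refine (hfin.union (Set.toFinite {0, G.length e})).subset ?_
  rintro t ⟨⟨h0, h1⟩, h⟩
  rcases h0.eq_or_lt with h0 | h0
  · exact Or.inr (Or.inl h0.symm)
  rcases h1.eq_or_lt with h1 | h1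
  · exact Or.inr (Or.inr h1)
  refine Or.inl ⟨?_, h0, h1⟩
  rcases h with h | ⟨x, hx⟩
  · exact h
  · simp [onEdge, h0, h1] at hx

theorem subdivisionEdges_finite {V E : Type*} [Finite E] (G : WeightedGraph V E)
    (S : Finset G.Realization) : (G.subdivisionEdges S).Finite := by
  have h : (⋃ e : E, ({e} : Set E) ×ˢ (G.cuts S e ×ˢ G.cuts S e)).Finite :=
    Set.finite_iUnion fun e =>
      (Set.finite_singleton e).prod ((G.cuts_finite S e).prod (G.cuts_finite S e))
  refine h.subset ?_
  rintro ⟨e, s, t⟩ ⟨hs, ht, -⟩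
  exact Set.mem_iUnion.2 ⟨e, ⟨rfl, hs, ht⟩⟩

noncomputable instance {V E : Type*} [Finite E] (G : WeightedGraph V E)
    (S : Finset G.Realization) : Fintype (G.subdivisionEdges S) :=
  (G.subdivisionEdges_finite S).fintype

/-- The oriented multigraph underlying the refinement of `G` with vertex set `V ∪ S`. -/
noncomputable def subdivisionGraph {V E : Type*} (G : WeightedGraph V E)
    (S : Finset G.Realization) :
    Multigraph (G.subdivisionVertices S) (G.subdivisionEdges S) where
  tail c := ⟨G.onEdge c.1.1 c.1.2.1, c.2.1.2⟩
  head c := ⟨G.onEdge c.1.1 c.1.2.2, c.2.2.1.2⟩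

theorem subdivisionGraph_reach {V E : Type*} (G : WeightedGraph V E) (S : Finset G.Realization)
    (e : E) (n : ℕ) : ∀ t (ht : t ∈ G.cuts S e), (G.cuts S e ∩ Set.Iio t).ncard = n →
      Nonempty ((G.subdivisionGraph S).EdgePath
        ⟨.vertex (G.tail e), Or.inr ⟨_, rfl⟩⟩ ⟨G.onEdge e t, ht.2⟩) := by
  induction n using Nat.strong_induction_on with
  | _ n ih =>
    intro t ht hn
    rcases ht.1.1.eq_or_lt with h0 | h0
    · subst h0
      have : (⟨G.onEdge e 0, ht.2⟩ : G.subdivisionVertices S)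
          = ⟨.vertex (G.tail e), Or.inr ⟨_, rfl⟩⟩ := Subtype.ext (G.onEdge_zero e)
      rw [this]
      exact ⟨.nil _⟩
    · have hfin : (G.cuts S e ∩ Set.Iio t).Finite := (G.cuts_finite S e).inter_of_left _
      obtain ⟨s, hs, hmax⟩ := hfin.exists_maximal ⟨0, G.zero_mem_cuts S e, h0⟩
      have hlt : (G.cuts S e ∩ Set.Iio s).ncard < n := by
        rw [← hn]
        refine Set.ncard_lt_ncard ⟨fun u hu => ⟨hu.1, lt_trans (Set.mem_Iio.1 hu.2) (Set.mem_Iio.1 hs.2)⟩, fun h => ?_⟩ hfin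
        exact lt_irrefl s (h hs).2
      obtain ⟨P⟩ := ih _ hlt s hs.1 rfl
      refine P.nonempty_trans ⟨.forward
        (⟨(e, s, t), hs.1, ht, hs.2, fun u hu h => ?_⟩ : G.subdivisionEdges S) rfl rfl (.nil _)⟩
      exact absurd (hmax ⟨hu, h.2⟩ h.1.le) (not_le.2 h.1)

theorem subdivisionGraph_connected {V E : Type*} (G : WeightedGraph V E)
    (S : Finset G.Realization) : (G.subdivisionGraph S).IsConnected := by
  have hedge : ∀ e : E, Nonempty ((G.subdivisionGraph S).EdgePath
      ⟨.vertex (G.tail e), Or.inr ⟨_, rfl⟩⟩ ⟨.vertex (G.head e), Or.inr ⟨_, rfl⟩⟩) := by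
    intro e
    have h := G.subdivisionGraph_reach S e _ _ (G.length_mem_cuts S e) rfl
    have : (⟨G.onEdge e (G.length e), (G.length_mem_cuts S e).2⟩ : G.subdivisionVertices S)
        = ⟨.vertex (G.head e), Or.inr ⟨_, rfl⟩⟩ := Subtype.ext (G.onEdge_length e)
    rwa [this] at h
  have hvert : ∀ {x y : V}, G.EdgePath x y → Nonempty ((G.subdivisionGraph S).EdgePath
      ⟨.vertex x, Or.inr ⟨_, rfl⟩⟩ ⟨.vertex y, Or.inr ⟨_, rfl⟩⟩) := by
    intro x y P
    induction P with
    | nil => exact ⟨.nil _⟩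
    | forward e hx hy P ih =>
      subst hx hy
      exact (hedge e).some.nonempty_trans ih
    | backward e hx hy P ih =>
      subst hx hy
      exact (hedge e).some.nonempty_symm.some.nonempty_trans ih
  have key : ∀ z : G.subdivisionVertices S, ∃ x : V, Nonempty ((G.subdivisionGraph S).EdgePath
      ⟨.vertex x, Or.inr ⟨_, rfl⟩⟩ z) := by
    rintro ⟨z, hz⟩
    cases z with
    | vertex x => exact ⟨x, ⟨.nil _⟩⟩
    | inner e t h0 h1 =>
      have ht : G.onEdge e t = .inner e t h0 h1 := by simp [onEdge, h0, h1]
      have := G.subdivisionGraph_reach S e _ t ⟨⟨h0.le, h1.le⟩, by rwa [ht]⟩ rfl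
      refine ⟨G.tail e, ?_⟩
      have h : (⟨.inner e t h0 h1, hz⟩ : G.subdivisionVertices S) = ⟨G.onEdge e t, by rwa [ht]⟩ :=
        Subtype.ext ht.symm
      rwa [h]
  intro y z
  obtain ⟨a, ⟨P⟩⟩ := key y
  obtain ⟨b, hQ⟩ := key z
  exact P.nonempty_symm.some.nonempty_trans
    ((hvert (G.connected a b).some).some.nonempty_trans hQ)

/-- The model of `Γ` that refines `G` by turning the points of the finite set `S` into vertices. -/
noncomputable def subdivision {V E : Type*} (G : WeightedGraph V E) (S : Finset G.Realization) :
    WeightedGraph (G.subdivisionVertices S) (G.subdivisionEdges S) where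
  toMultigraph := G.subdivisionGraph S
  nonempty := G.nonempty.map fun x => ⟨.vertex x, Or.inr ⟨x, rfl⟩⟩
  connected := G.subdivisionGraph_connected S
  length c := c.1.2.2 - c.1.2.1
  length_pos c := sub_pos.2 c.2.2.2.1

/-- The push-forward `r_*` of `1`-forms: `r_*(de) = ∑ de'`, summed over the parts `e'` of `e`. -/
def pushForward {V E : Type*} (G : WeightedGraph V E) (S : Finset G.Realization) :
    (E → ℝ) →ₗ[ℝ] (G.subdivisionEdges S → ℝ) where
  toFun ω c := ω c.1.1
  map_add' _ _ := rfl
  map_smul' _ _ := rfl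

open Classical in
/-- The paths from `x` to `y` in the model of `Γ` that refines `G` by making `x` and `y` vertices. -/
abbrev PathBetween {V E : Type*} (G : WeightedGraph V E) (x y : G.Realization) : Type _ :=
  (G.subdivision {x, y}).EdgePath ⟨x, Or.inl (by simp)⟩ ⟨y, Or.inl (by simp)⟩

/-- The path metric of `Γ`: the infimum of the lengths of the paths from `x` to `y`. -/
noncomputable def pathDist {V E : Type*} (G : WeightedGraph V E) (x y : G.Realization) : ℝ :=
  ⨅ P : G.PathBetween x y, P.weight (G.subdivision _).length

/-- The functional `ω ↦ ∫_{α_P} r_*(ω)` on `Ω(Γ) = Ω(G)` of a path `P` in `Γ`. -/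
noncomputable def pathFunctional {V E : Type*} [Fintype E] (G : WeightedGraph V E)
    {x y : G.Realization} (P : G.PathBetween x y) : G.FormsDual :=
  LinearMap.toContinuousLinearMap
    (((G.subdivision _).integral fun c => (P.chain c : ℝ)) ∘ₗ G.pushForward _ ∘ₗ
      G.harmonicForms.subtype)

/-- The Abel–Jacobi map `Φ_p : Γ → J(Γ)`: `Φ_p(q)` is the class of `∫_{α_P}`, where `P` is any path
from `p` to `q` in a model of `Γ` that has `p` and `q` among its vertices. -/
noncomputable def abelJacobi {V E : Type*} [Fintype E] (G : WeightedGraph V E)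
    (p q : G.Realization) : G.Jacobian :=
  QuotientAddGroup.mk (G.pathFunctional
    (Classical.choice ((G.subdivision _).connected _ _) : G.PathBetween p q))

/-- `Γ` is `2`-edge-connected: it is connected and removing (the interior of) any one segment
leaves it connected. -/
def TwoEdgeConnected {V E : Type*} (G : WeightedGraph V E) : Prop :=
  G.IsConnected ∧ ∀ e : E, (G.deleteEdge e).IsConnected

end WeightedGraph

/-! ### The tropical metric of a tropical torus `(W / Λ, Λ')` -/

/-- `v` is a primitive element of `Λ'`: not of the form `n v'` with `v' ∈ Λ'` and `n > 1`. -/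
def IsPrimitive {W : Type*} [AddCommGroup W] (Λ' : AddSubgroup W) (v : W) : Prop :=
  v ∈ Λ' ∧ ¬ ∃ v' ∈ Λ', ∃ n : ℤ, 1 < n ∧ v = n • v'

/-- The set `ℝΛ'` of all real multiples of elements of `Λ'`. -/
def realMultiples {W : Type*} [AddCommGroup W] [Module ℝ W] (Λ' : AddSubgroup W) : Set W :=
  {v | ∃ t : ℝ, ∃ v' ∈ Λ', v = t • v'}

/-- The tropical length of `v ∈ ℝΛ'`: it is `|t|` if `v = t u` with `u ∈ Λ'` primitive. (The set below
has just one element, except that it is empty if `Λ' = 0` and `v = 0`, where the length is `0`.) -/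
noncomputable def tropicalLength {W : Type*} [AddCommGroup W] [Module ℝ W] (Λ' : AddSubgroup W)
    (v : W) : ℝ :=
  sInf {r : ℝ | ∃ t : ℝ, ∃ u, IsPrimitive Λ' u ∧ v = t • u ∧ r = |t|}

/-- `F` is a continuous lift to `W` of the path `c : [a, b] → W / Λ`. -/
def IsLiftOn {W : Type*} [AddCommGroup W] [TopologicalSpace W] (Λ : AddSubgroup W)
    (c : ℝ → W ⧸ Λ) (a b : ℝ) (F : ℝ → W) : Prop :=
  ContinuousOn F (Set.Icc a b) ∧ ∀ t ∈ Set.Icc a b, (QuotientAddGroup.mk (F t) : W ⧸ Λ) = c t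

/-- The path `c : [a, b] → W / Λ` is piecewise affine, with straight pieces in directions of `ℝΛ'`,
and the tropical lengths of these pieces add up to `L`. -/
def HasTropicalLength {W : Type*} [AddCommGroup W] [Module ℝ W] [TopologicalSpace W]
    (Λ Λ' : AddSubgroup W) (c : ℝ → W ⧸ Λ) (a b L : ℝ) : Prop :=
  ∃ (F : ℝ → W) (n : ℕ) (τ : ℕ → ℝ), IsLiftOn Λ c a b F ∧ Monotone τ ∧ τ 0 = a ∧ τ n = b ∧
    (∀ i < n, ∃ w ∈ realMultiples Λ', ∀ t ∈ Set.Icc (τ i) (τ (i + 1)),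
      F t = F (τ i) + (t - τ i) • w) ∧
    L = ∑ i ∈ Finset.range n, tropicalLength Λ' (F (τ (i + 1)) - F (τ i))

namespace WeightedGraph

/-- The map `f` from `Γ` to the tropical torus `(W / Λ, Λ')` is a tropical isometry along the
segment `e`. -/
structure IsTropicalIsometryAlong {V E : Type*} (G : WeightedGraph V E)
    {W : Type*} [AddCommGroup W] [Module ℝ W] [TopologicalSpace W] [ContinuousSMul ℝ W]
    (Λ Λ' : AddSubgroup W)
    (f : G.Realization → W ⧸ Λ) (e : E) : Prop where
  /-- The differential of `f` carries unit tangent vectors of `e` (at the ends of `e`: one-sided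
  ones) to tangent vectors in `ℝΛ'` of tropical length `1`. -/
  tangent : ∃ F : ℝ → W, IsLiftOn Λ (fun t => f (G.onEdge e t)) 0 (G.length e) F ∧
    ∀ t ∈ Set.Icc 0 (G.length e), ∃ w ∈ realMultiples Λ',
      HasDerivWithinAt F w (Set.Icc 0 (G.length e)) t ∧ tropicalLength Λ' w = 1
  /-- Locally on `e`, the tropical length of the image of the part of `e` between two points is the
  distance of the two points in `Γ`. -/
  dist : ∀ x ∈ Set.Icc 0 (G.length e), ∃ ε > 0, ∀ s ∈ Set.Icc 0 (G.length e),
    ∀ t ∈ Set.Icc 0 (G.length e), |s - x| < ε → |t - x| < ε → s ≤ t →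
      HasTropicalLength Λ Λ' (fun u => f (G.onEdge e u)) s t
        (G.pathDist (G.onEdge e s) (G.onEdge e t))
  /-- Every part of `e`, and `e` itself, has the same length as its image. -/
  length : ∀ s t, 0 ≤ s → s ≤ t → t ≤ G.length e →
    HasTropicalLength Λ Λ' (fun u => f (G.onEdge e u)) s t (t - s)

end WeightedGraph

/-! On a segment `e` the map lifts to the affine path `C + t • evalEdge e`: lengthening a path along
`e` by `t` adds `t ω_e` to its integral, and changing the path changes the integral only by a
period. Everything therefore depends on the single vector `evalEdge e`, and there is a dichotomy.

If no chain avoiding `e` joins its ends, `e` is a bridge. Summing the harmonicity equations over one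
side of the cut gives `ω_e = 0`, so `e` is collapsed. Otherwise `e` completes to an integral cycle
with coefficient `1` at `e`. Read as a harmonic form, this cycle takes the value `1` under `evalEdge
e`, which forces `evalEdge e` to be primitive. Hence `t • evalEdge e` has tropical length `|t|`, and
the lift has unit speed.

For (b), distances in `Γ` must also be compared with parameters on `e`. Collapsing the rest of `Γ`
to a point makes `e` a circle, so parameters at most `ℓ(e)/2` apart are at that same distance in
`Γ`.

The dichotomy is carried by `evalEdge_eq_zero` and `exists_integral_form`, the lift by
`exists_abelJacobi_onEdge`, the lengths by `tropicalLength_smul_evalEdge` and `pathDist_onEdge`. -/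

namespace Multigraph

/-! ### Boundaries and connectedness by chains -/

open Classical in
/-- The boundary of an integral `1`-chain. -/
noncomputable def boundary {V E : Type*} [Fintype E] (G : Multigraph V E) :
    (E → ℤ) →+ (V → ℤ) where
  toFun α x := ∑ e with G.head e = x, α e - ∑ e with G.tail e = x, α e
  map_zero' := by ext x; simp
  map_add' α β := by
    ext x
    simp only [Pi.add_apply, Finset.sum_add_distrib]
    ring

open Classical in
theorem boundary_single {V E : Type*} [Fintype E] (G : Multigraph V E) (e : E) :
    G.boundary (Pi.single e 1) = Pi.single (G.head e) 1 - Pi.single (G.tail e) 1 := by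
  ext x
  simp only [boundary, AddMonoidHom.coe_mk, ZeroHom.coe_mk, Pi.sub_apply, Finset.sum_filter,
    Pi.single_apply]
  congr 1
  · rw [Finset.sum_eq_single e (fun b _ hb => by simp [hb]) (by simp)]
    simp [eq_comm]
  · rw [Finset.sum_eq_single e (fun b _ hb => by simp [hb]) (by simp)]
    simp [eq_comm]

/-- This turns connectedness by paths into connectedness by chains: it is applied with `Q` a
`chainComponent`. -/
theorem EdgePath.mem_of_closed {V E : Type*} {G : Multigraph V E} {Q : Set V}
    (hf : ∀ e, G.tail e ∈ Q → G.head e ∈ Q) (hb : ∀ e, G.head e ∈ Q → G.tail e ∈ Q)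
    {x y : V} (P : G.EdgePath x y) : x ∈ Q → y ∈ Q := by
  induction P with
  | nil => exact id
  | forward e hx hy P ih =>
    subst hx hy
    exact fun h => ih (hf e h)
  | backward e hx hy P ih =>
    subst hx hy
    exact fun h => ih (hb e h)

open Classical in
/-- The vertices `y` such that `y - x` is the boundary of an integral chain that avoids the
edges outside `D`. -/
def chainComponent {V E : Type*} [Fintype E] (G : Multigraph V E) (D : Set E) (x : V) : Set V :=
  {y | ∃ α : E → ℤ, (∀ e ∉ D, α e = 0) ∧ G.boundary α = Pi.single y 1 - Pi.single x 1}

theorem self_mem_chainComponent {V E : Type*} [Fintype E] (G : Multigraph V E) (D : Set E)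
    (x : V) : x ∈ G.chainComponent D x :=
  ⟨0, by simp, by simp⟩

theorem head_mem_chainComponent {V E : Type*} [Fintype E] (G : Multigraph V E) {D : Set E}
    {x : V} {e : E} (he : e ∈ D) (h : G.tail e ∈ G.chainComponent D x) :
    G.head e ∈ G.chainComponent D x := by
  classical
  obtain ⟨α, hα, hb⟩ := h
  refine ⟨α + Pi.single e 1, fun e' he' => ?_, ?_⟩
  · have : e' ≠ e := fun h => he' (h ▸ he)
    simp [hα e' he', this]
  · rw [map_add, hb, boundary_single]
    simp only [Pi.single]
    abel

theorem tail_mem_chainComponent {V E : Type*} [Fintype E] (G : Multigraph V E) {D : Set E}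
    {x : V} {e : E} (he : e ∈ D) (h : G.head e ∈ G.chainComponent D x) :
    G.tail e ∈ G.chainComponent D x := by
  classical
  obtain ⟨α, hα, hb⟩ := h
  refine ⟨α - Pi.single e 1, fun e' he' => ?_, ?_⟩
  · have : e' ≠ e := fun h => he' (h ▸ he)
    simp [hα e' he', this]
  · rw [map_sub, hb, boundary_single]
    simp only [Pi.single]
    abel

end Multigraph

/-! ### The slope functional of an edge -/

namespace WeightedGraph

/-- The functional `ω ↦ ω_e`. -/
noncomputable def evalEdge {V E : Type*} [Fintype E] (G : WeightedGraph V E) (e : E) :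
    G.FormsDual :=
  LinearMap.toContinuousLinearMap (LinearMap.proj e ∘ₗ G.harmonicForms.subtype)

@[simp]
theorem evalEdge_apply {V E : Type*} [Fintype E] (G : WeightedGraph V E) (e : E)
    (ω : G.harmonicForms) : G.evalEdge e ω = (ω : E → ℝ) e := rfl

theorem mem_cycles_iff {V E : Type*} [Fintype E] (G : WeightedGraph V E) {α : E → ℤ} :
    α ∈ G.cycles ↔ G.boundary α = 0 :=
  funext_iff.symm

open Classical in
theorem integralFunctional_single {V E : Type*} [Fintype E] (G : WeightedGraph V E) (e : E) :
    G.integralFunctional (Pi.single e 1) = G.length e • G.evalEdge e := by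
  ext ω
  simp only [integralFunctional, integral, AddMonoidHom.coe_mk, ZeroHom.coe_mk,
    LinearMap.coe_toContinuousLinearMap', LinearMap.comp_apply, LinearMap.coe_mk, AddHom.coe_mk,
    smul_apply, evalEdge_apply, smul_eq_mul, Submodule.subtype_apply]
  rw [Finset.sum_eq_single e (fun b _ hb => by simp [hb]) (by simp)]
  simp [mul_comm]

/-! ### Path independence -/

open Classical in
/-- There is a function on the points of `Γ` whose differences along the segments are, up to
periods, the integrals along the segments. -/
theorem exists_potential {V E : Type*} [Fintype E] (G : WeightedGraph V E) :
    ∃ ψ : G.Realization → G.FormsDual, ∀ e, ∀ t ∈ Set.Icc 0 (G.length e),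
      ψ (G.onEdge e t) - ψ (.vertex (G.tail e)) - t • G.evalEdge e ∈ G.periodLattice := by
  obtain ⟨x₀⟩ := G.nonempty
  have hmem : ∀ x, x ∈ G.chainComponent Set.univ x₀ := fun x =>
    (G.connected x₀ x).some.mem_of_closed
      (fun _ h => G.head_mem_chainComponent (Set.mem_univ _) h)
      (fun _ h => G.tail_mem_chainComponent (Set.mem_univ _) h) (G.self_mem_chainComponent _ _)
  choose α _ hα using hmem
  -- Integrate from `x₀` along the chosen chain to a vertex; for an interior point, go to the tail
  -- of its edge and then along the edge.
  refine ⟨fun z => Realization.rec (fun x => G.integralFunctional (α x))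
    (fun e t _ _ => G.integralFunctional (α (G.tail e)) + t • G.evalEdge e) z,
    fun e t ht => ?_⟩
  unfold onEdge
  split_ifs with h0 h1
  · convert G.periodLattice.zero_mem using 1
    simp only
    abel
  · have : t = G.length e := le_antisymm ht.2 (not_lt.1 h1)
    subst this
    -- Only at the head can a nonzero period occur: the chain chosen for the head and the one
    -- through the tail and `e` differ by a cycle.
    refine ⟨α (G.head e) - α (G.tail e) - Pi.single e 1, ?_, ?_⟩
    · refine (G.mem_cycles_iff).2 ?_
      rw [map_sub, map_sub, hα, hα, Multigraph.boundary_single]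
      simp only [Pi.single]
      abel
    · simp only [map_sub, integralFunctional_single]
  · have : t = 0 := le_antisymm (not_lt.1 h0) ht.1
    subst this
    convert G.periodLattice.zero_mem using 1
    module

/-- The functional `ω ↦ ∫_α r_*(ω)` of an integral chain `α` of a model of `Γ`. -/
noncomputable def chainFunctional {V E : Type*} [Fintype E] (G : WeightedGraph V E)
    (S : Finset G.Realization) (α : G.subdivisionEdges S → ℤ) : G.FormsDual :=
  LinearMap.toContinuousLinearMap
    (((G.subdivision S).integral fun c => (α c : ℝ)) ∘ₗ G.pushForward _ ∘ₗ
      G.harmonicForms.subtype)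

theorem chainFunctional_apply {V E : Type*} [Fintype E] (G : WeightedGraph V E)
    (S : Finset G.Realization) (α : G.subdivisionEdges S → ℤ) (ω : G.harmonicForms) :
    G.chainFunctional S α ω =
      ∑ c, (α c : ℝ) * (ω : E → ℝ) c.1.1 * (c.1.2.2 - c.1.2.1) := rfl

theorem chainFunctional_add {V E : Type*} [Fintype E] (G : WeightedGraph V E)
    (S : Finset G.Realization) (α β : G.subdivisionEdges S → ℤ) :
    G.chainFunctional S (α + β) = G.chainFunctional S α + G.chainFunctional S β := by
  ext ω
  simp only [chainFunctional_apply, add_apply, ← Finset.sum_add_distrib, Pi.add_apply,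
    Int.cast_add]
  exact Finset.sum_congr rfl fun c _ => by ring

theorem chainFunctional_neg {V E : Type*} [Fintype E] (G : WeightedGraph V E)
    (S : Finset G.Realization) (α : G.subdivisionEdges S → ℤ) :
    G.chainFunctional S (-α) = -G.chainFunctional S α := by
  ext ω
  simp only [chainFunctional_apply, neg_apply, ← Finset.sum_neg_distrib, Pi.neg_apply,
    Int.cast_neg]
  exact Finset.sum_congr rfl fun c _ => by ring

open Classical in
theorem chainFunctional_single {V E : Type*} [Fintype E] (G : WeightedGraph V E)
    (S : Finset G.Realization) (c : G.subdivisionEdges S) :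
    G.chainFunctional S (Pi.single c 1) = (c.1.2.2 - c.1.2.1) • G.evalEdge c.1.1 := by
  ext ω
  simp only [chainFunctional_apply, smul_apply, evalEdge_apply, smul_eq_mul]
  rw [Finset.sum_eq_single c (fun b _ hb => by simp [hb]) (by simp)]
  simp [mul_comm]

theorem sub_sub_add_mem {W : Type*} [AddCommGroup W] {Λ : AddSubgroup W} {x y z a b : W}
    (h₁ : z - y - b ∈ Λ) (h₂ : y - x - a ∈ Λ) : z - x - (a + b) ∈ Λ := by
  convert Λ.add_mem h₁ h₂ using 1
  abel

theorem sub_sub_neg_add_mem {W : Type*} [AddCommGroup W] {Λ : AddSubgroup W} {x y z a b : W}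
    (h₁ : z - y - b ∈ Λ) (h₂ : x - y - a ∈ Λ) : z - x - (-a + b) ∈ Λ := by
  convert Λ.sub_mem h₁ h₂ using 1
  abel

/-- The differences of `ψ` telescope along the path, so modulo periods the integral depends only on
the end points. This makes the arbitrary choice of path in `abelJacobi` harmless. -/
theorem chainFunctional_chain_sub_mem {V E : Type*} [Fintype E] (G : WeightedGraph V E)
    {ψ : G.Realization → G.FormsDual} (hψ : ∀ e, ∀ t ∈ Set.Icc 0 (G.length e),
      ψ (G.onEdge e t) - ψ (.vertex (G.tail e)) - t • G.evalEdge e ∈ G.periodLattice)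
    (S : Finset G.Realization) {x y : G.subdivisionVertices S}
    (P : (G.subdivision S).EdgePath x y) :
    ψ y - ψ x - G.chainFunctional S P.chain ∈ G.periodLattice := by
  classical
  have hedge : ∀ c : G.subdivisionEdges S,
      ψ (G.onEdge c.1.1 c.1.2.2) - ψ (G.onEdge c.1.1 c.1.2.1)
        - G.chainFunctional S (Pi.single c 1) ∈ G.periodLattice := fun c => by
    have h := G.periodLattice.sub_mem (hψ c.1.1 _ c.2.2.1.1) (hψ c.1.1 _ c.2.1.1)
    rw [chainFunctional_single]
    convert h using 1
    module
  induction P with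
  | nil x =>
    have : G.chainFunctional S 0 = 0 := by ext ω; simp [chainFunctional_apply]
    rw [Multigraph.EdgePath.chain, this]
    convert G.periodLattice.zero_mem using 1
    abel
  | forward c hx hy P ih =>
    subst hx hy
    rw [Multigraph.EdgePath.chain, chainFunctional_add]
    exact sub_sub_add_mem ih (by convert hedge c <;> rfl)
  | backward c hx hy P ih =>
    subst hx hy
    rw [Multigraph.EdgePath.chain, chainFunctional_add, chainFunctional_neg]
    exact sub_sub_neg_add_mem ih (by convert hedge c <;> rfl)

/-- Along the segment `e`, the Abel–Jacobi map lifts to an affine map of slope `ω ↦ ω_e`. -/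
theorem exists_abelJacobi_onEdge {V E : Type*} [Fintype E] (G : WeightedGraph V E)
    (p : G.Realization) (e : E) : ∃ C : G.FormsDual, ∀ t ∈ Set.Icc 0 (G.length e),
      (QuotientAddGroup.mk (C + t • G.evalEdge e) : G.Jacobian)
        = G.abelJacobi p (G.onEdge e t) := by
  obtain ⟨ψ, hψ⟩ := G.exists_potential
  refine ⟨ψ (.vertex (G.tail e)) - ψ p, fun t ht => ?_⟩
  refine (QuotientAddGroup.eq).2 ?_
  -- The path chosen in `abelJacobi` varies with `t` in an uncontrolled way; subtracting the two
  -- congruences cancels `ψ` at the moving end point.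
  have h := G.periodLattice.sub_mem (hψ e t ht) (G.chainFunctional_chain_sub_mem hψ _
    (Classical.choice ((G.subdivision _).connected _ _) : G.PathBetween p (G.onEdge e t)))
  convert h using 1
  simp only [pathFunctional, chainFunctional]
  abel

/-! ### Edges that are not bridges -/

/-- The functional `ω ↦ ω_e` vanishes if `e` is a bridge. -/
theorem evalEdge_eq_zero {V E : Type*} [Fintype E] (G : WeightedGraph V E) (e : E) (A : Set V)
    (hA : ∀ e' ≠ e, (G.head e' ∈ A ↔ G.tail e' ∈ A)) (ht : G.tail e ∈ A) (hh : G.head e ∉ A) :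
    G.evalEdge e = 0 := by
  classical
  ext ω
  -- `V` carries no finiteness assumption, so `A` is cut down to the vertices that meet an edge;
  -- this changes neither sum.
  set T : Finset V := {x ∈ Finset.univ.image G.head ∪ Finset.univ.image G.tail | x ∈ A} with hT
  have hhead : ∀ e', G.head e' ∈ T ↔ G.head e' ∈ A := fun e' => by simp [hT]
  have htail : ∀ e', G.tail e' ∈ T ↔ G.tail e' ∈ A := fun e' => by simp [hT]
  have hsum : ∑ x ∈ T, ∑ e' with G.head e' = x, (ω : E → ℝ) e'
      = ∑ x ∈ T, ∑ e' with G.tail e' = x, (ω : E → ℝ) e' :=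
    Finset.sum_congr rfl fun x _ => by convert ω.2 x
  simp only [Finset.sum_filter] at hsum
  rw [Finset.sum_comm, Finset.sum_comm (s := T)] at hsum
  simp only [Finset.sum_ite_eq, hhead, htail] at hsum
  -- Every edge other than `e` has both ends in `A` or neither, so it cancels and only `ω_e`
  -- survives.
  rw [← sub_eq_zero, ← Finset.sum_sub_distrib, Finset.sum_eq_single e
    (fun e' _ he' => by simp [hA e' he']) (by simp)] at hsum
  simpa [ht, hh] using hsum

/-- An integral harmonic form with coefficient `1` at `e`, for an edge `e` such that
`e^+ - e^-` is the boundary of a chain avoiding `e`. -/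
theorem exists_integral_form {V E : Type*} [Fintype E] (G : WeightedGraph V E) (e : E)
    (h : G.head e ∈ G.chainComponent {e}ᶜ (G.tail e)) :
    ∃ ω : G.harmonicForms, (∀ e', ∃ n : ℤ, (ω : E → ℝ) e' = n) ∧ (ω : E → ℝ) e = 1 := by
  classical
  obtain ⟨α, hα, hb⟩ := h
  -- Closing the detour `α` with `e` gives a cycle. Cycles and harmonic forms satisfy the same
  -- vertex equations, so it serves as the form.
  have hcyc : G.boundary (Pi.single e 1 - α) = 0 := by
    rw [map_sub, hb, Multigraph.boundary_single]
    simp only [Pi.single]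
    abel
  refine ⟨⟨fun e' => ((Pi.single e 1 - α : E → ℤ) e' : ℝ), fun x => ?_⟩, fun e' => ⟨_, rfl⟩, ?_⟩
  · have := congrFun hcyc x
    have h2 := sub_eq_zero.1 this
    beta_reduce
    exact_mod_cast h2
  · simp [hα e (by simp)]

/-- If the head of `e` could not be reached from the tail without `e`, the chain component of the
tail would be one side of a cut crossed by `e` alone. -/
theorem exists_integral_form_of_evalEdge_ne_zero {V E : Type*} [Fintype E]
    (G : WeightedGraph V E) (e : E) (h : G.evalEdge e ≠ 0) :
    ∃ ω : G.harmonicForms, (∀ e', ∃ n : ℤ, (ω : E → ℝ) e' = n) ∧ (ω : E → ℝ) e = 1 := by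
  refine G.exists_integral_form e ?_
  by_contra hh
  exact h (G.evalEdge_eq_zero e _ (fun e' he' => ⟨G.tail_mem_chainComponent he',
    G.head_mem_chainComponent he'⟩) (G.self_mem_chainComponent _ _) hh)

theorem TwoEdgeConnected.exists_integral_form {V E : Type*} [Fintype E]
    {G : WeightedGraph V E} (h : G.TwoEdgeConnected) (e : E) :
    ∃ ω : G.harmonicForms, (∀ e', ∃ n : ℤ, (ω : E → ℝ) e' = n) ∧ (ω : E → ℝ) e = 1 :=
  G.exists_integral_form e <| Multigraph.EdgePath.mem_of_closed (G := G.deleteEdge e)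
    (fun e' h => G.head_mem_chainComponent (D := {e}ᶜ) e'.2 h)
    (fun e' h => G.tail_mem_chainComponent (D := {e}ᶜ) e'.2 h)
    (h.2 e (G.tail e) (G.head e)).some (G.self_mem_chainComponent _ _)

/-! ### Tropical lengths -/

theorem evalEdge_mem_tropicalStructure {V E : Type*} [Fintype E] (G : WeightedGraph V E)
    (e : E) : G.evalEdge e ∈ G.tropicalStructure :=
  fun _ hω => hω e

/-- Evaluation at the given form `ω` does both jobs: it shows that `evalEdge e` is primitive, and
that a primitive vector on the same line is `± evalEdge e`. So the set whose infimum is taken is a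
singleton. -/
theorem tropicalLength_smul_evalEdge {V E : Type*} [Fintype E] (G : WeightedGraph V E) {e : E}
    (h : ∃ ω : G.harmonicForms, (∀ e', ∃ n : ℤ, (ω : E → ℝ) e' = n) ∧ (ω : E → ℝ) e = 1)
    (t : ℝ) : tropicalLength G.tropicalStructure (t • G.evalEdge e) = |t| := by
  obtain ⟨ω, hω, hωe⟩ := h
  have hprim : IsPrimitive G.tropicalStructure (G.evalEdge e) := by
    refine ⟨G.evalEdge_mem_tropicalStructure e, ?_⟩
    rintro ⟨v, hv, n, hn, hnv⟩
    obtain ⟨m, hm⟩ := hv ω hω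
    have h1 := DFunLike.congr_fun hnv ω
    rw [evalEdge_apply, hωe, smul_apply, hm, zsmul_eq_mul] at h1
    have h2 : (1 : ℤ) = n * m := by exact_mod_cast h1
    have := Int.le_of_dvd one_pos ⟨m, h2⟩
    omega
  have hset : {r : ℝ | ∃ t' : ℝ, ∃ u, IsPrimitive G.tropicalStructure u ∧
      t • G.evalEdge e = t' • u ∧ r = |t'|} = {|t|} := by
    ext r
    simp only [Set.mem_ofPred_eq, Set.mem_singleton_iff]
    refine ⟨?_, fun hr => ⟨t, _, hprim, rfl, hr⟩⟩
    rintro ⟨t', u, ⟨hu, hu'⟩, htu, rfl⟩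
    rcases eq_or_ne t' 0 with rfl | ht'
    · have h1 := DFunLike.congr_fun htu ω
      simp only [smul_apply, evalEdge_apply, hωe, smul_eq_mul, mul_one, zero_mul] at h1
      simp [h1]
    obtain ⟨m, hm⟩ := hu ω hω
    have h1 := DFunLike.congr_fun htu ω
    simp only [smul_apply, evalEdge_apply, hωe, smul_eq_mul, mul_one, hm] at h1
    -- The integer `m = u(ω)` is the ratio of `u` to `evalEdge e`; primitivity of `u` then leaves
    -- only `m = ±1`.
    have hum : u = m • G.evalEdge e := by
      have : t' • u = t' • (m • G.evalEdge e) := by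
        rw [← htu, h1]
        module
      exact smul_right_injective _ ht' this
    have hm1 : |m| = 1 := by
      by_contra hne
      rcases lt_trichotomy m 0 with hm0 | rfl | hm0
      · rw [abs_of_neg hm0] at hne
        exact hu' ⟨-G.evalEdge e, neg_mem (G.evalEdge_mem_tropicalStructure e), -m, by omega,
          by rw [hum]; module⟩
      · exact hu' ⟨0, zero_mem _, 2, by norm_num, by rw [hum]; simp⟩
      · rw [abs_of_pos hm0] at hne
        exact hu' ⟨G.evalEdge e, G.evalEdge_mem_tropicalStructure e, m, by omega, hum⟩
    rw [h1, abs_mul, ← Int.cast_abs, hm1]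
    simp
  rw [tropicalLength, hset, csInf_singleton]

theorem hasTropicalLength_of_affine_lift {W : Type*} [AddCommGroup W] [Module ℝ W]
    [TopologicalSpace W] [ContinuousAdd W] [ContinuousSMul ℝ W] {Λ Λ' : AddSubgroup W}
    {c : ℝ → W ⧸ Λ} {a b : ℝ} (hab : a ≤ b) (C : W) {w : W} (hw : w ∈ realMultiples Λ')
    (hc : ∀ t ∈ Set.Icc a b, (QuotientAddGroup.mk (C + t • w) : W ⧸ Λ) = c t) :
    HasTropicalLength Λ Λ' c a b (tropicalLength Λ' ((b - a) • w)) := by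
  -- One straight piece; `τ` stays at `b` after index `0`, since it must be monotone on all of `ℕ`.
  refine ⟨fun t => C + t • w, 1, fun i => if i = 0 then a else b, ⟨?_, hc⟩, ?_, by simp,
    by simp, ?_, ?_⟩
  · exact (continuous_const.add (continuous_id.smul continuous_const)).continuousOn
  · refine monotone_nat_of_le_succ fun i => ?_
    by_cases hi : i = 0 <;> simp [hi, hab]
  · intro i _
    refine ⟨w, hw, fun t _ => ?_⟩
    simp only [sub_smul]
    abel
  · simp [sub_smul]

/-! ### Distances -/

theorem weight_nonneg {V E : Type*} (G : WeightedGraph V E) {x y : V} (P : G.EdgePath x y) :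
    0 ≤ P.weight G.length := by
  induction P with
  | nil => exact le_rfl
  | forward e _ _ P ih => exact add_nonneg (G.length_pos e).le ih
  | backward e _ _ P ih => exact add_nonneg (G.length_pos e).le ih

/-- A function that is 1-Lipschitz along every segment bounds path lengths from below, because its
increments along the pieces of a path add up. -/
theorem abs_sub_le_weight {V E : Type*} (G : WeightedGraph V E) {f : G.Realization → ℝ}
    (hf : ∀ e, ∀ a ∈ Set.Icc 0 (G.length e), ∀ b ∈ Set.Icc 0 (G.length e),
      |f (G.onEdge e b) - f (G.onEdge e a)| ≤ |b - a|)
    (S : Finset G.Realization) {x y : G.subdivisionVertices S}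
    (P : (G.subdivision S).EdgePath x y) :
    |f y - f x| ≤ P.weight (G.subdivision S).length := by
  have hedge : ∀ c : G.subdivisionEdges S,
      |f (G.onEdge c.1.1 c.1.2.2) - f (G.onEdge c.1.1 c.1.2.1)|
        ≤ (G.subdivision S).length c := fun c => by
    refine (hf _ _ c.2.1.1 _ c.2.2.1.1).trans_eq ?_
    exact abs_of_pos ((G.subdivision S).length_pos c)
  induction P with
  | nil => simp [Multigraph.EdgePath.weight]
  | forward c hx hy P ih =>
    subst hx hy
    rw [Multigraph.EdgePath.weight]
    exact (abs_sub_le _ _ _).trans ((add_comm _ _).trans_le (add_le_add (hedge c) ih))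
  | backward c hx hy P ih =>
    subst hx hy
    rw [Multigraph.EdgePath.weight]
    refine (abs_sub_le _ _ _).trans ((add_comm _ _).trans_le (add_le_add ?_ ih))
    rw [abs_sub_comm]
    exact hedge c

open Classical in
/-- The circular distance on the segment `e` from the point with parameter `s`, extended by a
constant to the other segments. -/
noncomputable def circularDist {V E : Type*} (G : WeightedGraph V E) (e : E) (s : ℝ) :
    G.Realization → ℝ := fun z =>
  Realization.rec (fun _ => min s (G.length e - s))
    (fun e' u _ _ => if e' = e then min |u - s| (G.length e - |u - s|)
      else min s (G.length e - s)) z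

theorem circularDist_onEdge_self {V E : Type*} (G : WeightedGraph V E) (e : E) {s u : ℝ}
    (hs : s ∈ Set.Icc 0 (G.length e)) (hu : u ∈ Set.Icc 0 (G.length e)) :
    G.circularDist e s (G.onEdge e u) = min |u - s| (G.length e - |u - s|) := by
  unfold onEdge
  split_ifs with h0 h1
  · simp [circularDist]
  · have : u = G.length e := le_antisymm hu.2 (not_lt.1 h1)
    simp only [circularDist, this, abs_of_nonneg (sub_nonneg.2 hs.2), sub_sub_cancel]
    exact min_comm _ _
  · have : u = 0 := le_antisymm (not_lt.1 h0) hu.1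
    simp [circularDist, this, abs_of_nonneg hs.1]

theorem circularDist_onEdge_of_ne {V E : Type*} (G : WeightedGraph V E) {e e' : E} (h : e' ≠ e)
    (s u : ℝ) : G.circularDist e s (G.onEdge e' u) = min s (G.length e - s) := by
  unfold onEdge
  split_ifs <;> simp [circularDist, h]

/-- On `e` this is the minimum of two 1-Lipschitz functions, the lengths of the two arcs of the
circle obtained by collapsing the rest of `Γ`; on the other segments it is constant. -/
theorem abs_circularDist_sub_le {V E : Type*} (G : WeightedGraph V E) (e : E) {s : ℝ}
    (hs : s ∈ Set.Icc 0 (G.length e)) (e' : E) :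
    ∀ a ∈ Set.Icc 0 (G.length e'), ∀ b ∈ Set.Icc 0 (G.length e'),
      |G.circularDist e s (G.onEdge e' b) - G.circularDist e s (G.onEdge e' a)| ≤ |b - a| := by
  intro a ha b hb
  by_cases h : e' = e
  · subst h
    rw [G.circularDist_onEdge_self e' hs ha, G.circularDist_onEdge_self e' hs hb]
    have key : |(|b - s| - |a - s|)| ≤ |b - a| := by
      simpa using abs_abs_sub_abs_le_abs_sub (b - s) (a - s)
    refine (abs_min_sub_min_le_max _ _ _ _).trans (max_le key ?_)
    rw [sub_sub_sub_cancel_left, abs_sub_comm]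
    exact key
  · simp [G.circularDist_onEdge_of_ne h]

/-- The part of `e` between the two points gives the upper bound, `circularDist` the lower one. The
bound `hle` ensures that the direct arc is not longer than the way round, which matters for example
when `e` is a loop. -/
theorem pathDist_onEdge {V E : Type*} (G : WeightedGraph V E) (e : E) {s t : ℝ}
    (hs : s ∈ Set.Icc 0 (G.length e)) (ht : t ∈ Set.Icc 0 (G.length e)) (hst : s ≤ t)
    (hle : t - s ≤ G.length e / 2) :
    G.pathDist (G.onEdge e s) (G.onEdge e t) = t - s := by
  classical
  have hbdd : BddBelow (Set.range fun P : G.PathBetween (G.onEdge e s) (G.onEdge e t) =>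
      P.weight (G.subdivision _).length) := ⟨0, by rintro _ ⟨P, rfl⟩; exact weight_nonneg _ P⟩
  have hne : Nonempty (G.PathBetween (G.onEdge e s) (G.onEdge e t)) :=
    (G.subdivision _).connected _ _
  refine le_antisymm ?_ (le_ciInf fun P => ?_)
  · rcases hst.eq_or_lt with rfl | hlt
    · refine (ciInf_le hbdd (.nil _)).trans ?_
      simp [Multigraph.EdgePath.weight]
    -- For `s < t` these are successive cuts: an interior point of `e` is no vertex and has only one
    -- parameter, so nothing strictly between them is cut.
    · have hc : (e, s, t) ∈ G.subdivisionEdges {G.onEdge e s, G.onEdge e t} := by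
        refine ⟨⟨hs, Or.inl (by simp)⟩, ⟨ht, Or.inl (by simp)⟩, hlt, fun u hu h => ?_⟩
        dsimp only at h
        have h0 : 0 < u := hs.1.trans_lt h.1
        have h1 : u < G.length e := h.2.trans_le ht.2
        have hinner : G.onEdge e u = .inner e u h0 h1 := by simp [onEdge, h0, h1]
        have hinj : ∀ v, G.onEdge e u = G.onEdge e v → u = v := by
          intro v hv
          rw [hinner] at hv
          unfold onEdge at hv
          split_ifs at hv
          simpa using hv
        rcases hu.2 with hu | ⟨x, hx⟩
        · simp only [Finset.coe_insert, Finset.coe_singleton, Set.mem_insert_iff,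
            Set.mem_singleton_iff] at hu
          rcases hu with hu | hu
          · exact h.1.ne' (hinj _ hu)
          · exact h.2.ne (hinj _ hu)
        · rw [hinner] at hx
          cases hx
      refine (ciInf_le hbdd (.forward ⟨_, hc⟩ rfl rfl (.nil _))).trans ?_
      simp [Multigraph.EdgePath.weight, subdivision]
  · have h := G.abs_sub_le_weight (G.abs_circularDist_sub_le e hs) _ P
    rw [G.circularDist_onEdge_self e hs hs, G.circularDist_onEdge_self e hs ht] at h
    have h0 : 0 ≤ t - s := sub_nonneg.2 hst
    rw [abs_of_nonneg h0, min_eq_left (by linarith), sub_self, abs_zero,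
      min_eq_left (by linarith [G.length_pos e]), sub_zero, abs_of_nonneg h0] at h
    convert h

/-! ### Isometry along an edge -/

theorem hasDerivAt_add_smul {W : Type*} [NormedAddCommGroup W] [NormedSpace ℝ W] (C w : W)
    (t : ℝ) : HasDerivAt (fun t : ℝ => C + t • w) w t := by
  simpa using ((hasDerivAt_id t).smul_const w).const_add C

/-- The one affine lift along `e` serves all three conditions. -/
theorem isTropicalIsometryAlong_abelJacobi {V E : Type*} [Fintype E] (G : WeightedGraph V E)
    (p : G.Realization) {e : E}
    (h : ∃ ω : G.harmonicForms, (∀ e', ∃ n : ℤ, (ω : E → ℝ) e' = n) ∧ (ω : E → ℝ) e = 1) :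
    G.IsTropicalIsometryAlong G.periodLattice G.tropicalStructure (G.abelJacobi p) e := by
  obtain ⟨C, hC⟩ := G.exists_abelJacobi_onEdge p e
  have : IsTopologicalAddGroup G.FormsDual := inferInstance
  have hadd : ContinuousAdd G.FormsDual := this.toContinuousAdd
  have hw : G.evalEdge e ∈ realMultiples G.tropicalStructure :=
    ⟨1, _, G.evalEdge_mem_tropicalStructure e, (one_smul _ _).symm⟩
  have hlen : ∀ s t, 0 ≤ s → s ≤ t → t ≤ G.length e →
      HasTropicalLength G.periodLattice G.tropicalStructure
        (fun u => G.abelJacobi p (G.onEdge e u)) s t (t - s) := fun s t h0 hst h1 => by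
    have := hasTropicalLength_of_affine_lift (Λ := G.periodLattice)
      (c := fun u => G.abelJacobi p (G.onEdge e u)) hst C hw
      fun u hu => hC u ⟨h0.trans hu.1, hu.2.trans h1⟩
    rwa [G.tropicalLength_smul_evalEdge h, abs_of_nonneg (sub_nonneg.2 hst)] at this
  refine ⟨⟨fun t => C + t • G.evalEdge e, ⟨?_, hC⟩, fun t _ => ⟨_, hw, ?_, ?_⟩⟩, fun x _ =>
    -- Two points within `ℓ(e)/4` of `x` are at most `ℓ(e)/2` apart, as `pathDist_onEdge` requires.
    ⟨G.length e / 4, by linarith [G.length_pos e], fun s hs t ht hsx htx hst => ?_⟩, hlen⟩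
  · exact (continuous_const.add (continuous_id.smul continuous_const)).continuousOn
  · exact (hasDerivAt_add_smul C (G.evalEdge e) t).hasDerivWithinAt
  · simpa using G.tropicalLength_smul_evalEdge h 1
  · rw [abs_lt] at hsx htx
    rw [G.pathDist_onEdge e hs ht hst (by linarith)]
    exact hlen s t hs.1 hst ht.2

end WeightedGraph

theorem mainTheorem4 {V E : Type*} [Fintype E] (G : WeightedGraph V E) (p : G.Realization) :
    (∀ e : E, ¬ (G.abelJacobi p '' G.segment e).Subsingleton →
      G.IsTropicalIsometryAlong G.periodLattice G.tropicalStructure (G.abelJacobi p) e) ∧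
    (G.TwoEdgeConnected → ∀ e : E,
      G.IsTropicalIsometryAlong G.periodLattice G.tropicalStructure (G.abelJacobi p) e) := by
  refine ⟨fun e he => ?_, fun h e => G.isTropicalIsometryAlong_abelJacobi p
    (h.exists_integral_form e)⟩
  refine G.isTropicalIsometryAlong_abelJacobi p
    (G.exists_integral_form_of_evalEdge_ne_zero e fun h0 => he ?_)
  -- With slope zero the lift is the constant `C`, so the segment would be collapsed.
  obtain ⟨C, hC⟩ := G.exists_abelJacobi_onEdge p e
  rintro _ ⟨_, ⟨s, hs, rfl⟩, rfl⟩ _ ⟨_, ⟨t, ht, rfl⟩, rfl⟩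
  rw [← hC s hs, ← hC t ht, h0, smul_zero, smul_zero]
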